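/- Two players play $3n$ rounds of Rock–Paper–Scissors ($n\ge 0$). In each round both players simultaneously choose a move, at random if they wish, with probabilities that may depend on all moves made by both players in earlier rounds. The restricted player must use each of the three moves exactly $n$ times during the game; the normal player is unrestricted. Let $S_n$ be the final score of the normal player, i.e. the number of rounds that this player wins minus the number that this player loses. A randomized strategy of the normal player is optimal if it maximizes, over all randomized strategies of this player, the minimum of $\mathbb E S_n$ over all strategies of the restricted player; a randomized strategy of the restricted player is optimal if it minimizes, over all randomized strategies of that player, the maximum of $\mathbb E S_n$ over all strategies of the normal player. For every $n$, both players have optimal strategies. Let $S^{\mathrm{opt}}_n$ be the final score of the normal player when both players use optimal strategies. Then, for any choice of optimal strategies for each $n$, $$\mathbb E S^{\mathrm{opt}}_n \sim \sqrt{\frac{27n}{4\pi}} = \frac{3\sqrt3}{2\sqrt\pi}\,\sqrt n \qquad\text{as } n\to\infty,$$ where $\frac{3\sqrt3}{2\sqrt\pi}\approx 1.4658$ (with an error less than $0.00005$). -/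

import Mathlib

open Filter Asymptotics

namespace SemiRPS

/-- The three moves Rock, Paper, Scissors, numbered `0, 1, 2`. Addition on `Fin 3` is modulo 3,
and move `i + 1` beats move `i`. -/
abbrev Move : Type := Fin 3

/-- A history: the list of the rounds played so far, oldest first. A round is a pair
`(i, j)`, where `i` is the move of the restricted player and `j` that of the normal player. -/
abbrev History : Type := List (Move × Move)

/-- Payoff of one round to the normal player, who plays `j` against the restricted player's `i`. -/
def payoff (i j : Move) : ℝ :=
  if j = i + 1 then 1 else if i = j + 1 then -1 else 0

/-- A randomized strategy of the normal player: after each history, a probability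
distribution for the next move. -/
structure NormalStrategy where
  prob : History → Move → ℝ
  prob_mem : ∀ h, prob h ∈ stdSimplex ℝ Move

/-- A randomized strategy of the restricted player in the game of `3 * n` rounds: after each
history, a probability distribution for the next move, where a move that the restricted player
has already used `n` times is not chosen again. Since there are `3 * n` rounds,
each move is then used exactly `n` times. -/
structure RestrictedStrategy (n : ℕ) where
  prob : History → Move → ℝ
  prob_mem : ∀ h, prob h ∈ stdSimplex ℝ Move
  legal : ∀ h : History, h.length < 3 * n →
    ∀ i : Move, n ≤ (h.map Prod.fst).count i → prob h i = 0

/-- A complete play of the game: the moves in each of the `3 * n` rounds. -/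
abbrev Play (n : ℕ) : Type := Fin (3 * n) → Move × Move

/-- The history of the play `ω` before round `t` (rounds are numbered from `0`). -/
def Play.before {n : ℕ} (ω : Play n) (t : Fin (3 * n)) : History :=
  (List.ofFn ω).take t

/-- The final score of the normal player: rounds won minus rounds lost. -/
def Play.score {n : ℕ} (ω : Play n) : ℝ :=
  ∑ t, payoff (ω t).1 (ω t).2

/-- The probability of the play `ω` under the two strategies. In each round, the two players
choose their moves simultaneously, hence independently given the history. -/
def playProb {n : ℕ} (ρ : RestrictedStrategy n) (σ : NormalStrategy) (ω : Play n) : ℝ :=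
  ∏ t, ρ.prob (ω.before t) (ω t).1 * σ.prob (ω.before t) (ω t).2

/-- The expected final score of the normal player. -/
noncomputable def expectedScore {n : ℕ} (ρ : RestrictedStrategy n) (σ : NormalStrategy) : ℝ :=
  ∑ ω : Play n, playProb ρ σ ω * ω.score

/-- `σ` is optimal for the normal player in the game of `3 * n` rounds: it maximizes the
expected score guaranteed against all strategies of the restricted player, i.e. it guarantees
every level `v` that some strategy guarantees. -/
def NormalStrategy.IsOptimal (n : ℕ) (σ : NormalStrategy) : Prop :=
  ∀ (σ' : NormalStrategy) (v : ℝ),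
    (∀ ρ : RestrictedStrategy n, v ≤ expectedScore ρ σ') →
      ∀ ρ : RestrictedStrategy n, v ≤ expectedScore ρ σ

/-- `ρ` is optimal for the restricted player: it minimizes the largest expected score that the
normal player can reach against it, i.e. it enforces every upper bound `v` that some strategy
enforces. -/
def RestrictedStrategy.IsOptimal {n : ℕ} (ρ : RestrictedStrategy n) : Prop :=
  ∀ (ρ' : RestrictedStrategy n) (v : ℝ),
    (∀ σ : NormalStrategy, expectedScore ρ' σ ≤ v) →
      ∀ σ : NormalStrategy, expectedScore ρ σ ≤ v

end SemiRPS

/-!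
The value of the game is pinned down by one potential. Let `spread r` be the largest cyclic
difference `r (k + 1) - r k` of a position `r`, which records how many copies of each move the
restricted player has left, and let `meanSpread k r` be its mean after `k` steps of the free walk
that lowers a uniformly chosen coordinate by one.

*Lower bound.* Going from `r - e (i + 1)` to `r - e i` lowers the spread by at most one, and this
survives averaging (`meanSpread_sub_single`). Exactly because of this inequality the normal player
has a mixed move for which the payoff plus the next potential does not depend on the move of the
restricted player; the common value is then the present potential (`sum_equalizer`). At the end
all moves are used up and the spread vanishes, so the normal player guarantees
`meanSpread (3 * n)` of the initial position (`meanSpread_le_expectedScore`).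

*Upper bound.* The restricted player plays uniformly until a move is used up, and then plays the
two remaining moves with probabilities `1 / 3` and `2 / 3`. In the second phase
`twoMovePotential` bounds the score; it exceeds the spread by at most the square root of the number
of rounds left. In the first phase uniform play makes every payoff zero on average and
`meanSpread` a martingale, and that square root is dominated by a concave function of a quadratic
martingale, `errorTerm`, whose initial value is of order `n ^ (1 / 4)` (`expectedScore_le`).
Since `spread ≤ meanSpread`, the bounds fit together.

*The common main term.* The spread plus its mirror image is half of `∑ j, |3 * r j - ∑ i, r i|`,
so by symmetry the initial value of `meanSpread` is a multiple of the mean absolute deviation of a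
binomial variable. De Moivre's telescoping sum gives `3 n (3n choose n) 4 ^ n / 27 ^ n`
(`meanSpread_diagonal`), and Stirling's formula its asymptotics.

Optimal strategies exist because strategies form a compact space and the worst expected score is
semicontinuous in the strategy.
-/

namespace SemiRPS

/-! ### Expected scores by recursion on the number of rounds left -/

/-- The expected score of the normal player in the next `k` rounds after the history `h`, when
`w h x` is the probability that the round following `h` is `x`. -/
def expectedRest (w : History → Move × Move → ℝ) : ℕ → History → ℝ
  | 0, _ => 0
  | k + 1, h => ∑ x, w h x * (payoff x.1 x.2 + expectedRest w k (h ++ [x]))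

theorem sum_plays_succ {N : ℕ} (f : (Fin (N + 1) → Move × Move) → ℝ) :
    ∑ ω, f ω = ∑ x, ∑ ω : Fin N → Move × Move, f (Fin.cons x ω) := by
  rw [← (Fin.consEquiv (fun _ : Fin (N + 1) => Move × Move)).sum_comp, Fintype.sum_prod_type]
  rfl

theorem prod_cons {N : ℕ} (w : History → Move × Move → ℝ) (h : History) (x : Move × Move)
    (ω : Fin N → Move × Move) :
    ∏ t : Fin (N + 1), w (h ++ (List.ofFn (Fin.cons x ω : Fin (N + 1) → Move × Move)).take t)
        ((Fin.cons x ω : Fin (N + 1) → Move × Move) t) =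
      w h x * ∏ t : Fin N, w ((h ++ [x]) ++ (List.ofFn ω).take t) (ω t) := by
  rw [Fin.prod_univ_succ]
  simp [List.ofFn_succ]

theorem sum_prod_eq_one (w : History → Move × Move → ℝ) (hw : ∀ h, ∑ x, w h x = 1) (N : ℕ)
    (h : History) :
    ∑ ω : Fin N → Move × Move, ∏ t : Fin N, w (h ++ (List.ofFn ω).take t) (ω t) = 1 := by
  induction N generalizing h with
  | zero => simp
  | succ N ih =>
    rw [sum_plays_succ]
    simp_rw [prod_cons, ← Finset.mul_sum, ih, mul_one, hw]

theorem sum_prod_mul_score (w : History → Move × Move → ℝ) (hw : ∀ h, ∑ x, w h x = 1) (N : ℕ)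
    (h : History) :
    ∑ ω : Fin N → Move × Move, (∏ t : Fin N, w (h ++ (List.ofFn ω).take t) (ω t)) *
      ∑ t, payoff (ω t).1 (ω t).2 = expectedRest w N h := by
  induction N generalizing h with
  | zero => simp [expectedRest]
  | succ N ih =>
    rw [sum_plays_succ, expectedRest]
    refine Finset.sum_congr rfl fun x _ => ?_
    rw [← ih, mul_add, ← one_mul (payoff x.1 x.2), ← sum_prod_eq_one w hw N (h ++ [x]),
      Finset.sum_mul, Finset.mul_sum, Finset.mul_sum, ← Finset.sum_add_distrib]
    refine Finset.sum_congr rfl fun ω _ => ?_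
    rw [prod_cons, Fin.sum_univ_succ]
    simp only [Fin.cons_zero, Fin.cons_succ]
    ring

/-- The probability that the next round after a history is `x`. -/
def roundProb {n : ℕ} (ρ : RestrictedStrategy n) (σ : NormalStrategy) (h : History)
    (x : Move × Move) : ℝ :=
  ρ.prob h x.1 * σ.prob h x.2

theorem sum_roundProb {n : ℕ} (ρ : RestrictedStrategy n) (σ : NormalStrategy) (h : History) :
    ∑ x, roundProb ρ σ h x = 1 := by
  simp only [roundProb, Fintype.sum_prod_type, ← Finset.mul_sum, (σ.prob_mem h).2, mul_one,
    (ρ.prob_mem h).2]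

theorem expectedScore_eq {n : ℕ} (ρ : RestrictedStrategy n) (σ : NormalStrategy) :
    expectedScore ρ σ = expectedRest (roundProb ρ σ) (3 * n) [] := by
  rw [← sum_prod_mul_score _ (sum_roundProb ρ σ)]
  simp [expectedScore, playProb, Play.score, Play.before, roundProb]

theorem expectedRest_succ {n : ℕ} (ρ : RestrictedStrategy n) (σ : NormalStrategy) (k : ℕ)
    (h : History) :
    expectedRest (roundProb ρ σ) (k + 1) h = ∑ i, ∑ j, ρ.prob h i * σ.prob h j *
      (payoff i j + expectedRest (roundProb ρ σ) k (h ++ [(i, j)])) := by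
  simp only [expectedRest, Fintype.sum_prod_type, roundProb]

theorem payoff_le_one (i j : Move) : payoff i j ≤ 1 := by
  unfold payoff
  split_ifs <;> norm_num

/-- One-round upper bound: it suffices to bound the expectation for each move of the normal
player. -/
theorem expectedRest_succ_le {n : ℕ} (ρ : RestrictedStrategy n) (σ : NormalStrategy) (k : ℕ)
    (h : History) (B : ℝ)
    (H : ∀ j, ∑ i, ρ.prob h i *
      (payoff i j + expectedRest (roundProb ρ σ) k (h ++ [(i, j)])) ≤ B) :
    expectedRest (roundProb ρ σ) (k + 1) h ≤ B := by
  rw [expectedRest_succ, Finset.sum_comm]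
  calc _ = ∑ j, σ.prob h j * ∑ i, ρ.prob h i *
        (payoff i j + expectedRest (roundProb ρ σ) k (h ++ [(i, j)])) := by
        refine Finset.sum_congr rfl fun j _ => ?_
        rw [Finset.mul_sum]
        exact Finset.sum_congr rfl fun i _ => by ring
    _ ≤ ∑ j, σ.prob h j * B :=
        Finset.sum_le_sum fun j _ => mul_le_mul_of_nonneg_left (H j) ((σ.prob_mem h).1 j)
    _ = B := by rw [← Finset.sum_mul, (σ.prob_mem h).2, one_mul]

/-- One-round lower bound: it suffices to bound the expectation for each move that the
restricted player chooses with positive probability. -/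
theorem le_expectedRest_succ {n : ℕ} (ρ : RestrictedStrategy n) (σ : NormalStrategy) (k : ℕ)
    (h : History) (B : ℝ)
    (H : ∀ i, ρ.prob h i ≠ 0 → B ≤ ∑ j, σ.prob h j *
      (payoff i j + expectedRest (roundProb ρ σ) k (h ++ [(i, j)]))) :
    B ≤ expectedRest (roundProb ρ σ) (k + 1) h := by
  rw [expectedRest_succ]
  calc B = ∑ i, ρ.prob h i * B := by rw [← Finset.sum_mul, (ρ.prob_mem h).2, one_mul]
    _ ≤ ∑ i, ρ.prob h i * ∑ j, σ.prob h j *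
        (payoff i j + expectedRest (roundProb ρ σ) k (h ++ [(i, j)])) := by
        refine Finset.sum_le_sum fun i _ => ?_
        by_cases hi : ρ.prob h i = 0
        · simp [hi]
        · exact mul_le_mul_of_nonneg_left (H i hi) ((ρ.prob_mem h).1 i)
    _ = _ := by
        refine Finset.sum_congr rfl fun i _ => ?_
        rw [Finset.mul_sum]
        exact Finset.sum_congr rfl fun j _ => by ring

theorem expectedRest_le {n : ℕ} (ρ : RestrictedStrategy n) (σ : NormalStrategy) (k : ℕ)
    (h : History) : expectedRest (roundProb ρ σ) k h ≤ k := by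
  induction k generalizing h with
  | zero => simp [expectedRest]
  | succ k ih =>
    refine expectedRest_succ_le ρ σ k h _ fun j => ?_
    calc _ ≤ ∑ i, ρ.prob h i * ((k + 1 : ℕ) : ℝ) := by
          refine Finset.sum_le_sum fun i _ =>
            mul_le_mul_of_nonneg_left ?_ ((ρ.prob_mem h).1 i)
          push_cast
          linarith [payoff_le_one i j, ih (h ++ [(i, j)])]
      _ = _ := by rw [← Finset.sum_mul, (ρ.prob_mem h).2, one_mul]

/-! ### Remaining moves -/

/-- How often the restricted player may still use each move after the history `h`. This is an
integer, negative for a history in which a move has been overused. -/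
def left (n : ℕ) (h : History) (i : Move) : ℤ := n - (h.map Prod.fst).count i

theorem left_append (n : ℕ) (h : History) (x : Move × Move) :
    left n (h ++ [x]) = left n h - Pi.single x.1 1 := by
  ext i
  by_cases hi : i = x.1
  · subst hi
    simp [left, List.count_append]
    ring
  · have : x.1 ≠ i := fun e => hi e.symm
    simp [left, List.count_append, hi, this]

theorem left_nil (n : ℕ) : left n [] = fun _ => (n : ℤ) := by
  ext i
  simp [left]

theorem sum_left (n : ℕ) (h : History) : ∑ i, left n h i = 3 * n - h.length := by
  induction h using List.reverseRecOn with
  | nil => simp [left_nil]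
  | append_singleton h x ih =>
    rw [left_append]
    simp only [Pi.sub_apply, Finset.sum_sub_distrib, ih, Finset.sum_pi_single', List.length_append,
      Finset.mem_univ, if_true, List.length_singleton]
    push_cast
    ring

/-- After a legal history, a legal move keeps the history legal. -/
theorem left_append_nonneg {n : ℕ} (ρ : RestrictedStrategy n) {h : History} {i : Move}
    (hl : ∀ i, 0 ≤ left n h i) (hlen : h.length < 3 * n) (hi : ρ.prob h i ≠ 0) (j : Move)
    (l : Move) : 0 ≤ left n (h ++ [(i, j)]) l := by
  have h1 : (h.map Prod.fst).count i < n := by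
    by_contra hc
    exact hi (ρ.legal h hlen i (not_lt.mp hc))
  rw [left_append]
  by_cases e : l = i
  · subst e
    simp [left]
    omega
  · simpa [Pi.single_apply, e] using hl l

/-! ### The averaged spread -/

/-- The largest cyclic difference `r (k + 1) - r k`. -/
def spread (r : Move → ℤ) : ℤ := max (max (r 1 - r 0) (r 2 - r 1)) (r 0 - r 2)

/-- The expectation of `f` at the end of a walk of `k` steps that starts at `r` and in each step
subtracts a uniformly chosen unit vector. -/
noncomputable def walkMean (f : (Move → ℤ) → ℝ) : ℕ → (Move → ℤ) → ℝ
  | 0, r => f r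
  | k + 1, r => (∑ i, walkMean f k (r - Pi.single i 1)) / 3

/-- The expected spread at the end of a uniform walk of `k` steps; the potential of both
players. -/
noncomputable def meanSpread : ℕ → (Move → ℤ) → ℝ := walkMean fun r => (spread r : ℝ)

theorem meanSpread_succ (k : ℕ) (r : Move → ℤ) :
    meanSpread (k + 1) r = (∑ i, meanSpread k (r - Pi.single i 1)) / 3 := rfl

theorem spread_sub_single (r : Move → ℤ) (i : Move) :
    spread (r - Pi.single (i + 1) 1) ≤ spread (r - Pi.single i 1) + 1 := by
  fin_cases i <;> simp [spread] <;> omega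

/-- This inequality makes the equalizing mixed move of the normal player nonnegative. -/
theorem meanSpread_sub_single (k : ℕ) (r : Move → ℤ) (i : Move) :
    meanSpread k (r - Pi.single (i + 1) 1) ≤ meanSpread k (r - Pi.single i 1) + 1 := by
  induction k generalizing r with
  | zero =>
    simp only [meanSpread, walkMean]
    exact_mod_cast spread_sub_single r i
  | succ k ih =>
    rw [meanSpread_succ, meanSpread_succ, div_add_one (by norm_num)]
    refine div_le_div_of_nonneg_right ?_ (by norm_num)
    have h : ∀ j, meanSpread k (r - Pi.single (i + 1) 1 - Pi.single j 1) ≤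
        meanSpread k (r - Pi.single i 1 - Pi.single j 1) + 1 := fun j => by
      rw [sub_right_comm, sub_right_comm r (Pi.single i 1)]
      exact ih _
    simp only [Fin.sum_univ_three]
    linarith [h 0, h 1, h 2]

/-- The spread is convex and invariant under adding constants, so averaging increases it. -/
theorem spread_le_meanSpread (k : ℕ) (r : Move → ℤ) : (spread r : ℝ) ≤ meanSpread k r := by
  induction k generalizing r with
  | zero => exact le_rfl
  | succ k ih =>
    have h : 3 * spread r ≤ ∑ i, spread (r - Pi.single i 1) := by
      simp [spread, Fin.sum_univ_three, Pi.single_apply]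
      omega
    have h' : 3 * (spread r : ℝ) ≤ ∑ i, (spread (r - Pi.single i 1) : ℝ) := by exact_mod_cast h
    rw [meanSpread_succ, le_div_iff₀ (by norm_num)]
    linarith [Finset.sum_le_sum fun i (_ : i ∈ Finset.univ) => ih (r - Pi.single i 1)]

/-! ### The equalizing strategy of the normal player -/

/-- The mixed move of the normal player that makes the expected payoff plus `meanSpread k` of the next position the
same for every move of the restricted player. -/
noncomputable def equalizer (k : ℕ) (r : Move → ℤ) (j : Move) : ℝ :=
  (1 + meanSpread k (r - Pi.single (j + 1) 1) - meanSpread k (r - Pi.single (j + 2) 1)) / 3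

theorem equalizer_mem (k : ℕ) (r : Move → ℤ) : equalizer k r ∈ stdSimplex ℝ Move := by
  refine ⟨fun j => ?_, ?_⟩
  · have h := meanSpread_sub_single k r (j + 1)
    rw [add_assoc, show (1 : Move) + 1 = 2 from rfl] at h
    unfold equalizer
    linarith
  · simp only [equalizer, Fin.sum_univ_three, Fin.reduceAdd]
    ring

theorem sum_equalizer (k : ℕ) (r : Move → ℤ) (i : Move) :
    ∑ j, equalizer k r j * payoff i j + meanSpread k (r - Pi.single i 1) =
      meanSpread (k + 1) r := by
  rw [meanSpread_succ]
  fin_cases i <;> simp [equalizer, Fin.sum_univ_three, payoff] <;> ring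

/-- The normal player equalizes with respect to the position and the number of rounds that
remain after the current one. -/
noncomputable def equalizingStrategy (n : ℕ) : NormalStrategy where
  prob h := equalizer (3 * n - h.length - 1) (left n h)
  prob_mem _ := equalizer_mem _ _

theorem meanSpread_le_expectedRest {n : ℕ} (ρ : RestrictedStrategy n) (k : ℕ) (h : History)
    (hk : h.length + k = 3 * n) (hl : ∀ i, 0 ≤ left n h i) :
    meanSpread k (left n h) ≤ expectedRest (roundProb ρ (equalizingStrategy n)) k h := by
  induction k generalizing h with
  | zero =>
    -- All moves are used up, so the spread vanishes.
    have hs : ∑ i, left n h i = 0 := by rw [sum_left]; omega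
    have hz : left n h = 0 := by
      funext i
      exact (Finset.sum_eq_zero_iff_of_nonneg fun i _ => hl i).mp hs i (Finset.mem_univ i)
    simp [hz, meanSpread, walkMean, spread, expectedRest]
  | succ k ih =>
    refine le_expectedRest_succ ρ _ k h _ fun i hi => ?_
    have hq : (equalizingStrategy n).prob h = equalizer k (left n h) := by
      simp only [equalizingStrategy]
      congr 1
      omega
    have hs := (equalizer_mem k (left n h)).2
    rw [← sum_equalizer k (left n h) i, hq]
    simp only [mul_add, Finset.sum_add_distrib]
    gcongr
    calc _ = ∑ j, equalizer k (left n h) j * meanSpread k (left n h - Pi.single i 1) := by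
          rw [← Finset.sum_mul, hs, one_mul]
      _ ≤ _ := by
          refine Finset.sum_le_sum fun j _ =>
            mul_le_mul_of_nonneg_left ?_ ((equalizer_mem k (left n h)).1 j)
          have := ih (h ++ [(i, j)]) (by simp; omega)
            (left_append_nonneg ρ hl (by omega) hi j)
          rwa [left_append] at this

/-- The normal player guarantees the expected spread of the free uniform walk. -/
theorem meanSpread_le_expectedScore {n : ℕ} (ρ : RestrictedStrategy n) :
    meanSpread (3 * n) (fun _ => (n : ℤ)) ≤ expectedScore ρ (equalizingStrategy n) := by
  rw [expectedScore_eq, ← left_nil]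
  exact meanSpread_le_expectedRest ρ _ _ (by simp) (by simp [left_nil])

/-! ### A strategy of the restricted player -/

/-- The restricted player plays uniformly while all three moves are available. When only two
moves are available, the one that beats the other has probability `2 / 3`. If no move is available,
which cannot happen before the end of the game, the value is the uniform distribution. -/
noncomputable def restrictedMove (r : Move → ℤ) (i : Move) : ℝ :=
  if r i ≤ 0 ∧ ∃ l, 0 < r l then 0
  else if r (i + 1) ≤ 0 then
    (if r (i + 2) ≤ 0 ∧ 0 < r i then 1 else if 0 < r i then 2 / 3 else 1 / 3)
  else 1 / 3

theorem restrictedMove_mem (r : Move → ℤ) : restrictedMove r ∈ stdSimplex ℝ Move := by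
  refine ⟨fun i => ?_, ?_⟩
  · unfold restrictedMove
    split_ifs <;> norm_num
  · rcases lt_or_ge 0 (r 0) with h0 | h0 <;> rcases lt_or_ge 0 (r 1) with h1 | h1 <;>
      rcases lt_or_ge 0 (r 2) with h2 | h2 <;>
      simp [restrictedMove, Fin.sum_univ_three, Fin.exists_fin_succ, h0, h1, h2,
        not_le.mpr, not_lt.mpr] <;>
      norm_num

/-- The strategy of the restricted player that follows `restrictedMove`. -/
noncomputable def uniformStrategy (n : ℕ) : RestrictedStrategy n where
  prob h := restrictedMove (left n h)
  prob_mem _ := restrictedMove_mem _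
  legal h hlen i hi := by
    have hex : ∃ l, 0 < left n h l := by
      by_contra! hc
      have h1 := sum_left n h
      have h2 := Finset.sum_nonpos fun l (_ : l ∈ Finset.univ) => hc l
      omega
    exact if_pos ⟨by simp only [left]; omega, hex⟩

theorem restrictedMove_of_pos {r : Move → ℤ} (h : ∀ i, 0 < r i) (i : Move) :
    restrictedMove r i = 1 / 3 := by
  simp [restrictedMove, (h _).not_ge]

/-- Concavity of the square root; it makes both correction terms supermartingales. -/
theorem sqrt_mean_three {x y z : ℝ} (hx : 0 ≤ x) (hy : 0 ≤ y) (hz : 0 ≤ z) :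
    (√x + √y + √z) / 3 ≤ √((x + y + z) / 3) := by
  apply Real.le_sqrt_of_sq_le
  nlinarith [Real.sq_sqrt hx, Real.sq_sqrt hy, Real.sq_sqrt hz, sq_nonneg (√x - √y),
    sq_nonneg (√y - √z), sq_nonneg (√x - √z)]

/-- The potential when one move is used up: `a` copies remain of a move and `b` of the move
beating it. Its main part is `max a (b - a)`; the term under the root is the second moment of the
centred walk that the restricted player's mixture produces. -/
noncomputable def twoMovePotential (a b : ℝ) : ℝ :=
  (b + √((2 * a - b) ^ 2 + 2 * (a + b))) / 2

theorem twoMovePotential_step {a b : ℝ} (ha : 1 ≤ a) (hb : 1 ≤ b) :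
    1 / 3 * (1 + twoMovePotential (a - 1) b) + 2 / 3 * twoMovePotential a (b - 1) ≤
      twoMovePotential a b := by
  have h := sqrt_mean_three (x := (2 * (a - 1) - b) ^ 2 + 2 * (a - 1 + b))
    (y := (2 * a - (b - 1)) ^ 2 + 2 * (a + (b - 1)))
    (z := (2 * a - (b - 1)) ^ 2 + 2 * (a + (b - 1)))
    (by nlinarith [sq_nonneg (2 * (a - 1) - b)]) (by nlinarith [sq_nonneg (2 * a - (b - 1))])
    (by nlinarith [sq_nonneg (2 * a - (b - 1))])
  have e : ((2 * (a - 1) - b) ^ 2 + 2 * (a - 1 + b) +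
      ((2 * a - (b - 1)) ^ 2 + 2 * (a + (b - 1))) + ((2 * a - (b - 1)) ^ 2 + 2 * (a + (b - 1)))) / 3
      = (2 * a - b) ^ 2 + 2 * (a + b) := by ring
  rw [e] at h
  unfold twoMovePotential
  linarith

theorem add_le_twoMovePotential {a b : ℝ} (ha : 0 ≤ a) (hb : 0 ≤ b) (hab : a = 0 ∨ b = 0) :
    a + b ≤ twoMovePotential a b := by
  have h : 2 * a + b ≤ √((2 * a - b) ^ 2 + 2 * (a + b)) := by
    apply Real.le_sqrt_of_sq_le
    rcases hab with rfl | rfl <;> nlinarith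
  unfold twoMovePotential
  linarith

/-- The error term of the interior potential: the fourth root of a quadratic function for which
the uniform walk is a martingale. -/
noncomputable def errorTerm (r : Move → ℤ) : ℝ :=
  √(√(2 * ((r 0 - r 1) ^ 2 + (r 1 - r 2) ^ 2 + (r 2 - r 0) ^ 2) + 4 * (r 0 + r 1 + r 2)) / 2)

theorem errorTerm_step {r : Move → ℤ} (h : 1 ≤ r 0 + r 1 + r 2) :
    (∑ i, errorTerm (r - Pi.single i 1)) / 3 ≤ errorTerm r := by
  have h' : (1 : ℝ) ≤ r 0 + r 1 + r 2 := by exact_mod_cast h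
  simp only [errorTerm, Fin.sum_univ_three, Pi.sub_apply, Pi.single_apply]
  norm_num only [Fin.isValue, Fin.reduceEq, if_true, if_false]
  push_cast
  refine (sqrt_mean_three (by positivity) (by positivity) (by positivity)).trans
    (Real.sqrt_le_sqrt ?_)
  have h2 := sqrt_mean_three
    (x := 2 * ((r 0 - 1 - r 1 : ℝ) ^ 2 + (r 1 - r 2) ^ 2 + (r 2 - (r 0 - 1)) ^ 2)
      + 4 * (r 0 - 1 + r 1 + r 2))
    (y := 2 * ((r 0 - (r 1 - 1) : ℝ) ^ 2 + (r 1 - 1 - r 2) ^ 2 + (r 2 - r 0) ^ 2)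
      + 4 * (r 0 + (r 1 - 1) + r 2))
    (z := 2 * ((r 0 - r 1 : ℝ) ^ 2 + (r 1 - (r 2 - 1)) ^ 2 + (r 2 - 1 - r 0) ^ 2)
      + 4 * (r 0 + r 1 + (r 2 - 1)))
    (by nlinarith [sq_nonneg (r 0 - 1 - r 1 : ℝ), sq_nonneg (r 1 - r 2 : ℝ),
          sq_nonneg (r 2 - (r 0 - 1) : ℝ)])
    (by nlinarith [sq_nonneg (r 0 - (r 1 - 1) : ℝ), sq_nonneg (r 1 - 1 - r 2 : ℝ),
          sq_nonneg (r 2 - r 0 : ℝ)])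
    (by nlinarith [sq_nonneg (r 0 - r 1 : ℝ), sq_nonneg (r 1 - (r 2 - 1) : ℝ),
          sq_nonneg (r 2 - 1 - r 0 : ℝ)])
  ring_nf at h2 ⊢
  linarith

/-- On the boundary the two-move potential is at most the spread plus the error term. -/
theorem twoMovePotential_le {r : Move → ℤ} (hr : ∀ i, 0 ≤ r i) {c : Move} (hc : r c = 0) :
    twoMovePotential (r (c + 1)) (r (c + 2)) ≤ spread r + errorTerm r := by
  have key : ∀ a b s e : ℝ, 0 ≤ a → 0 ≤ b → a ≤ s → b - a ≤ s →
      e = √(√(2 * (a ^ 2 + b ^ 2 + (a - b) ^ 2) + 4 * (a + b)) / 2) →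
      twoMovePotential a b ≤ s + e := by
    intro a b s e ha hb h1 h2 he
    have h3 : √(2 * (a + b)) / 2 ≤ e := by
      rw [he]
      apply Real.le_sqrt_of_sq_le
      rw [div_pow, Real.sq_sqrt (by positivity)]
      have : a + b ≤ √(2 * (a ^ 2 + b ^ 2 + (a - b) ^ 2) + 4 * (a + b)) :=
        Real.le_sqrt_of_sq_le (by nlinarith [sq_nonneg (a - b)])
      linarith
    have h4 : √((2 * a - b) ^ 2 + 2 * (a + b)) ≤ |2 * a - b| + √(2 * (a + b)) := by
      rw [← Real.sqrt_sq_eq_abs]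
      exact Real.sqrt_le_iff.mpr ⟨by positivity, by
        nlinarith [Real.sq_sqrt (sq_nonneg (2 * a - b)),
          Real.sq_sqrt (by positivity : 0 ≤ 2 * (a + b)),
          mul_nonneg (Real.sqrt_nonneg ((2 * a - b) ^ 2)) (Real.sqrt_nonneg (2 * (a + b)))]⟩
    have h5 : (b + |2 * a - b|) / 2 ≤ s := by
      rcases abs_cases (2 * a - b) with ⟨e, _⟩ | ⟨e, _⟩ <;> rw [e] <;> linarith
    unfold twoMovePotential
    linarith
  have ha : (0 : ℝ) ≤ r (c + 1) := by exact_mod_cast hr _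
  have hb : (0 : ℝ) ≤ r (c + 2) := by exact_mod_cast hr _
  have h1 : r (c + 1) ≤ spread r ∧ r (c + 2) - r (c + 1) ≤ spread r := by
    fin_cases c <;> simp at hc <;> simp [spread, hc]
  refine key _ _ _ _ ha hb (by exact_mod_cast h1.1) (by exact_mod_cast h1.2) ?_
  unfold errorTerm
  congr 3
  fin_cases c <;> simp at hc <;> simp [hc] <;> ring

theorem sum_move (c : Move) (f : Move → ℝ) : ∑ i, f i = f c + f (c + 1) + f (c + 2) := by
  fin_cases c <;> simp [Fin.sum_univ_three] <;> ring

/-- The bound once some move is used up. -/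
theorem expectedRest_le_twoMovePotential {n : ℕ} (σ : NormalStrategy) (k : ℕ) (h : History)
    (hk : h.length + k = 3 * n) (hl : ∀ i, 0 ≤ left n h i) {c : Move} (hc : left n h c = 0) :
    expectedRest (roundProb (uniformStrategy n) σ) k h ≤
      twoMovePotential (left n h (c + 1)) (left n h (c + 2)) := by
  induction k generalizing h with
  | zero =>
    have ha : (0 : ℝ) ≤ left n h (c + 1) := by exact_mod_cast hl _
    have hb : (0 : ℝ) ≤ left n h (c + 2) := by exact_mod_cast hl _
    rw [expectedRest, twoMovePotential]
    positivity
  | succ k ih =>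
    have hsum : left n h (c + 1) + left n h (c + 2) = (k + 1 : ℕ) := by
      have := sum_left n h
      rw [Fin.sum_univ_three] at this
      fin_cases c <;> simp at hc ⊢ <;> omega
    by_cases hz : left n h (c + 1) = 0 ∨ left n h (c + 2) = 0
    · -- With a single kind of move left, the bound is the number of rounds left.
      refine (expectedRest_le _ σ _ h).trans ?_
      have : ((k + 1 : ℕ) : ℝ) = left n h (c + 1) + left n h (c + 2) := by
        exact_mod_cast hsum.symm
      rw [this]
      exact add_le_twoMovePotential (by exact_mod_cast hl _) (by exact_mod_cast hl _)
        (by exact_mod_cast hz)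
    · have h1 : 0 < left n h (c + 1) := by have := hl (c + 1); omega
      have h2 : 0 < left n h (c + 2) := by have := hl (c + 2); omega
      have p0 : (uniformStrategy n).prob h c = 0 := if_pos ⟨hc.le, _, h1⟩
      have p1 : (uniformStrategy n).prob h (c + 1) = 1 / 3 := by
        simp only [uniformStrategy, restrictedMove, add_assoc, Fin.reduceAdd]
        rw [if_neg (by simp [h1]), if_neg (by simp [h2])]
      have p2 : (uniformStrategy n).prob h (c + 2) = 2 / 3 := by
        simp only [uniformStrategy, restrictedMove, add_assoc, Fin.reduceAdd]
        rw [if_neg (by simp [h2]), if_pos (by simp [hc]), if_neg (by simp [h1]), if_pos h2]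
      refine expectedRest_succ_le _ σ k h _ fun j => ?_
      have i1 := ih (h ++ [(c + 1, j)]) (by simp; omega)
        (left_append_nonneg (uniformStrategy n) hl (by omega) (by rw [p1]; norm_num) j)
        (by rw [left_append]; simpa using hc)
      have i2 := ih (h ++ [(c + 2, j)]) (by simp; omega)
        (left_append_nonneg (uniformStrategy n) hl (by omega) (by rw [p2]; norm_num) j)
        (by rw [left_append]; simpa using hc)
      have ne : c + 1 ≠ c + 2 := by simp
      simp only [left_append, Pi.sub_apply, Pi.single_eq_same, Pi.single_eq_of_ne ne,
        Pi.single_eq_of_ne ne.symm] at i1 i2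
      push_cast at i1 i2
      rw [sub_zero] at i1 i2
      have hp : payoff (c + 1) j + 2 * payoff (c + 2) j ≤ 1 := by
        fin_cases c <;> fin_cases j <;> simp [payoff] <;> norm_num
      have hs := twoMovePotential_step (a := left n h (c + 1)) (b := left n h (c + 2))
        (by exact_mod_cast h1) (by exact_mod_cast h2)
      rw [sum_move c, p0, p1, p2]
      linarith

/-- The bound for all positions: the potential of the normal player plus the error term. -/
theorem expectedRest_le_meanSpread_add {n : ℕ} (σ : NormalStrategy) (k : ℕ) (h : History)
    (hk : h.length + k = 3 * n) (hl : ∀ i, 0 ≤ left n h i) :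
    expectedRest (roundProb (uniformStrategy n) σ) k h ≤
      meanSpread k (left n h) + errorTerm (left n h) := by
  induction k generalizing h with
  | zero =>
    have hs : ∑ i, left n h i = 0 := by rw [sum_left]; omega
    have hz : left n h 0 = 0 :=
      (Finset.sum_eq_zero_iff_of_nonneg fun i _ => hl i).mp hs 0 (Finset.mem_univ _)
    linarith [expectedRest_le_twoMovePotential σ 0 h hk hl hz, twoMovePotential_le hl hz,
      spread_le_meanSpread 0 (left n h)]
  | succ k ih =>
    by_cases hz : ∃ c, left n h c = 0
    · obtain ⟨c, hc⟩ := hz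
      linarith [expectedRest_le_twoMovePotential σ (k + 1) h hk hl hc, twoMovePotential_le hl hc,
        spread_le_meanSpread (k + 1) (left n h)]
    · push Not at hz
      have hpos : ∀ i, 0 < left n h i := fun i => (hl i).lt_of_ne' (hz i)
      have p : ∀ i, (uniformStrategy n).prob h i = 1 / 3 := restrictedMove_of_pos hpos
      refine expectedRest_succ_le _ σ k h _ fun j => ?_
      have hi : ∀ i, expectedRest (roundProb (uniformStrategy n) σ) k (h ++ [(i, j)]) ≤
          meanSpread k (left n h - Pi.single i 1) + errorTerm (left n h - Pi.single i 1) :=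
        fun i => by
          have := ih (h ++ [(i, j)]) (by simp; omega)
            (left_append_nonneg (uniformStrategy n) hl (by omega) (by rw [p]; norm_num) j)
          rwa [left_append] at this
      have hp : payoff 0 j + payoff 1 j + payoff 2 j = 0 := by
        fin_cases j <;> simp [payoff]
      have he := errorTerm_step (r := left n h) (by linarith [hpos 0, hpos 1, hpos 2])
      rw [meanSpread_succ]
      simp only [Fin.sum_univ_three, p] at he ⊢
      linarith [hi 0, hi 1, hi 2]

/-- The restricted player holds the score down to the expected spread plus `O(n ^ (1 / 4))`. -/
theorem expectedScore_le {n : ℕ} (σ : NormalStrategy) :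
    expectedScore (uniformStrategy n) σ ≤
      meanSpread (3 * n) (fun _ => (n : ℤ)) + √(√(12 * n) / 2) := by
  rw [expectedScore_eq]
  refine (expectedRest_le_meanSpread_add σ _ [] (by simp) (by simp [left_nil])).trans_eq ?_
  rw [left_nil, errorTerm]
  congr 4
  simp
  ring

/-! ### The expected spread in closed form -/

/-- The mean of `|z + S|`, where `S` is the sum of `k` independent steps that equal `-2` with
probability `1 / 3` and `1` with probability `2 / 3`. -/
noncomputable def absMean : ℕ → ℤ → ℝ
  | 0, z => |(z : ℝ)|
  | k + 1, z => absMean k (z - 2) / 3 + 2 * absMean k (z + 1) / 3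

theorem sum_choose_succ_mul (k : ℕ) (g : ℕ → ℝ) :
    ∑ i ∈ Finset.range (k + 2), ((k + 1).choose i : ℝ) * 2 ^ (k + 1 - i) * g i =
      ∑ i ∈ Finset.range (k + 1), (k.choose i : ℝ) * 2 ^ (k - i) * g (i + 1) +
      2 * ∑ i ∈ Finset.range (k + 1), (k.choose i : ℝ) * 2 ^ (k - i) * g i := by
  have h : 2 * ∑ i ∈ Finset.range (k + 1), (k.choose i : ℝ) * 2 ^ (k - i) * g i =
      ∑ i ∈ Finset.range (k + 2), (k.choose i : ℝ) * 2 ^ (k + 1 - i) * g i := by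
    rw [Finset.sum_range_succ _ (k + 1), Finset.mul_sum, Nat.choose_succ_self]
    simp only [Nat.cast_zero, zero_mul, add_zero]
    refine Finset.sum_congr rfl fun i hi => ?_
    rw [show k + 1 - i = (k - i) + 1 by have := Finset.mem_range.mp hi; omega, pow_succ]
    ring
  rw [h, Finset.sum_range_succ', Finset.sum_range_succ' _ (k + 1), ← add_assoc,
    ← Finset.sum_add_distrib]
  simp only [Nat.choose_zero_right, Nat.add_sub_add_right]
  congr 1
  refine Finset.sum_congr rfl fun i _ => ?_
  rw [Nat.choose_succ_succ]
  push_cast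
  ring

theorem absMean_eq (k : ℕ) (z : ℤ) : absMean k z =
    (∑ i ∈ Finset.range (k + 1), (k.choose i : ℝ) * 2 ^ (k - i) * |(z + k - 3 * i : ℝ)|) /
      3 ^ k := by
  induction k generalizing z with
  | zero => simp [absMean]
  | succ k ih =>
    rw [absMean, ih, ih, sum_choose_succ_mul k fun i => |(z + (k + 1 : ℕ) - 3 * i : ℝ)|]
    have h1 : ∀ i : ℕ, ((z - 2 : ℤ) + k - 3 * i : ℝ) = z + (k + 1 : ℕ) - 3 * (i + 1 : ℕ) :=
      fun i => by push_cast; ring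
    have h2 : ∀ i : ℕ, ((z + 1 : ℤ) + k - 3 * i : ℝ) = z + (k + 1 : ℕ) - 3 * i :=
      fun i => by push_cast; ring
    simp only [h1, h2, pow_succ]
    field_simp

/-- The mean of a deviation of a binomial variable telescopes (De Moivre). -/
theorem sum_deviation (m j : ℕ) (hj : j ≤ m + 1) :
    ∑ i ∈ Finset.range j, (m.choose i * 2 ^ (m - i) * (m - 3 * i) : ℝ) =
      j * m.choose j * 2 ^ (m + 1 - j) := by
  induction j with
  | zero => simp
  | succ j ih =>
    have h : ((j + 1 : ℕ) * m.choose (j + 1) : ℝ) = m.choose j * (m - j) := by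
      have := Nat.choose_succ_right_eq m j
      have h2 : ((m - j : ℕ) : ℝ) = m - j := Nat.cast_sub (by omega)
      rw [← h2, mul_comm]
      exact_mod_cast this
    rw [Finset.sum_range_succ, ih (by omega), h, show m + 1 - j = (m - j) + 1 by omega,
      show m + 1 - (j + 1) = m - j by omega, pow_succ]
    ring

theorem absMean_zero (n : ℕ) :
    absMean (3 * n) 0 = 4 * n * (3 * n).choose n * 4 ^ n / 27 ^ n := by
  rw [absMean_eq]
  have h0 := sum_deviation (3 * n) (3 * n + 1) le_rfl
  have h1 := sum_deviation (3 * n) n (by omega)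
  -- Since the deviations sum to zero, the absolute ones sum to twice those with `i < n`.
  have e : ∀ i ∈ Finset.range (3 * n + 1), ((3 * n).choose i * 2 ^ (3 * n - i) *
      |(((0 : ℤ) : ℝ) + (3 * n : ℕ) - 3 * i)| : ℝ) =
      2 * (if i < n then (3 * n).choose i * 2 ^ (3 * n - i) * ((3 * n : ℕ) - 3 * i : ℝ) else 0) -
      (3 * n).choose i * 2 ^ (3 * n - i) * ((3 * n : ℕ) - 3 * i : ℝ) := by
    intro i _
    push_cast
    split_ifs with h
    · have : (i : ℝ) < n := by exact_mod_cast h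
      rw [abs_of_nonneg (by linarith)]
      ring
    · have : (n : ℝ) ≤ i := by exact_mod_cast not_lt.mp h
      rw [abs_of_nonpos (by linarith)]
      ring
  rw [Finset.sum_congr rfl e, Finset.sum_sub_distrib, ← Finset.mul_sum, ← Finset.sum_filter, h0,
    show (Finset.range (3 * n + 1)).filter (· < n) = Finset.range n by ext; simp; omega, h1,
    Nat.choose_succ_self, show 3 * n + 1 - n = 2 * n + 1 by omega, pow_succ, pow_mul, pow_mul]
  norm_num
  ring

theorem walkMean_add (f g : (Move → ℤ) → ℝ) (k : ℕ) (r : Move → ℤ) :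
    walkMean (fun r => f r + g r) k r = walkMean f k r + walkMean g k r := by
  induction k generalizing r with
  | zero => rfl
  | succ k ih => simp only [walkMean, ih, Finset.sum_add_distrib, add_div]

theorem walkMean_comp_perm (f : (Move → ℤ) → ℝ) (π : Equiv.Perm Move) (k : ℕ) (r : Move → ℤ) :
    walkMean (fun r => f (r ∘ π)) k r = walkMean f k (r ∘ π) := by
  induction k generalizing r with
  | zero => rfl
  | succ k ih =>
    simp only [walkMean, ih]
    rw [← Equiv.sum_comp π]
    congr 1
    refine Finset.sum_congr rfl fun i _ => ?_
    congr 1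
    ext l
    simp [Pi.single_apply]

theorem walkMean_abs (j : Move) (k : ℕ) (r : Move → ℤ) :
    walkMean (fun r => |((3 * r j - ∑ i, r i : ℤ) : ℝ)|) k r =
      absMean k (3 * r j - ∑ i, r i) := by
  induction k generalizing r with
  | zero => simp [walkMean, absMean]
  | succ k ih =>
    have hs : ∀ i : Move, ∑ l, (r - Pi.single i 1 : Move → ℤ) l = ∑ l, r l - 1 := fun i => by
      simp [Finset.sum_sub_distrib]
    have h0 : ∀ z w : ℤ, z = w → absMean k z = absMean k w := fun _ _ e => by rw [e]
    simp only [walkMean, ih, hs, absMean]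
    rw [sum_move j]
    simp only [Pi.sub_apply, Pi.single_eq_same]
    rw [Pi.single_eq_of_ne (by simp), Pi.single_eq_of_ne (by simp),
      h0 (3 * (r j - 1) - (∑ l, r l - 1)) (3 * r j - ∑ l, r l - 2) (by ring),
      h0 (3 * (r j - 0) - (∑ l, r l - 1)) (3 * r j - ∑ l, r l + 1) (by ring)]
    ring

/-- The cyclic differences sum to zero, so their maximum plus the maximum of their negatives is
half the sum of their distances. Exchanging two moves reverses the orientation. -/
theorem spread_add_spread_swap (r : Move → ℤ) :
    2 * (spread r + spread (r ∘ Equiv.swap 0 1)) = ∑ j, |3 * r j - ∑ i, r i| := by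
  have h0 : Equiv.swap (0 : Move) 1 0 = 1 := by decide
  have h1 : Equiv.swap (0 : Move) 1 1 = 0 := by decide
  have h2 : Equiv.swap (0 : Move) 1 2 = 2 := by decide
  simp only [spread, Function.comp, h0, h1, h2, Fin.sum_univ_three]
  rcases abs_cases (3 * r 0 - (r 0 + r 1 + r 2)) with h | h <;>
  rcases abs_cases (3 * r 1 - (r 0 + r 1 + r 2)) with h' | h' <;>
  rcases abs_cases (3 * r 2 - (r 0 + r 1 + r 2)) with h'' | h'' <;>
  rw [h.1, h'.1, h''.1] <;> omega

theorem meanSpread_diagonal (n : ℕ) :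
    meanSpread (3 * n) (fun _ => (n : ℤ)) = 3 * n * (3 * n).choose n * 4 ^ n / 27 ^ n := by
  set d : Move → ℤ := fun _ => (n : ℤ) with hd
  set f : (Move → ℤ) → ℝ := fun r => (spread r : ℝ) with hf
  set g : Move → (Move → ℤ) → ℝ := fun j r => |((3 * r j - ∑ i, r i : ℤ) : ℝ)| with hg
  have hfun : (fun r => (f r + f (r ∘ Equiv.swap 0 1)) + (f r + f (r ∘ Equiv.swap 0 1))) =
      fun r => g 0 r + (g 1 r + g 2 r) := by
    funext r
    have h := spread_add_spread_swap r
    rw [Fin.sum_univ_three] at h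
    have h' : (2 * (spread r + spread (r ∘ Equiv.swap 0 1)) : ℝ) =
        |((3 * r 0 - ∑ i, r i : ℤ) : ℝ)| + |((3 * r 1 - ∑ i, r i : ℤ) : ℝ)| +
          |((3 * r 2 - ∑ i, r i : ℤ) : ℝ)| := by exact_mod_cast h
    simp only [hf, hg]
    linarith
  have h := congrArg (fun F => walkMean F (3 * n) d) hfun
  have hz : ∀ j, 3 * d j - ∑ i, d i = 0 := fun j => by simp [hd]
  simp only [walkMean_add, walkMean_comp_perm, hg, walkMean_abs, hz, absMean_zero] at h
  rw [show d ∘ Equiv.swap 0 1 = d from rfl] at h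
  change walkMean f (3 * n) d = _
  linear_combination h / 4

/-! ### Asymptotics -/

theorem meanSpread_isEquivalent :
    (fun n : ℕ => meanSpread (3 * n) (fun _ => (n : ℤ))) ~[atTop]
      (fun n : ℕ => √(27 * (n : ℝ) / (4 * Real.pi))) := by
  have S := Stirling.factorial_isEquivalent_stirling
  have t2 : Tendsto (fun n : ℕ => 2 * n) atTop atTop :=
    tendsto_id.const_mul_atTop' (by norm_num)
  have t3 : Tendsto (fun n : ℕ => 3 * n) atTop atTop :=
    tendsto_id.const_mul_atTop' (by norm_num)
  have S2 := S.comp_tendsto t2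
  have S3 := S.comp_tendsto t3
  have R : (fun n : ℕ => (3 * n * 4 ^ n / 27 ^ n : ℝ)) ~[atTop]
      (fun n : ℕ => (3 * n * 4 ^ n / 27 ^ n : ℝ)) := IsEquivalent.refl
  refine ((R.mul (S3.div (S.mul S2))).congr_left ?_).congr_right ?_
  · refine Eventually.of_forall fun n => ?_
    have hc : ((3 * n).choose n : ℝ) = (3 * n).factorial / (n.factorial * (2 * n).factorial) := by
      rw [Nat.cast_choose ℝ (by omega), show 3 * n - n = 2 * n by omega]
    simp only [Pi.mul_apply, Pi.div_apply, Function.comp, meanSpread_diagonal, hc]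
    ring
  · filter_upwards [eventually_gt_atTop 0] with n hn
    have hn' : (0 : ℝ) < n := by exact_mod_cast hn
    have hpi := Real.pi_pos
    have he := Real.exp_pos 1
    simp only [Pi.mul_apply, Pi.div_apply, Function.comp]
    push_cast
    have hs : √(27 * n / (4 * Real.pi)) * (√(2 * n * Real.pi) * √(2 * (2 * n) * Real.pi)) =
        3 * n * √(2 * (3 * n) * Real.pi) := by
      rw [← Real.sqrt_mul (by positivity), ← Real.sqrt_mul (by positivity),
        show 3 * n * √(2 * (3 * n) * Real.pi) = √((3 * n) ^ 2 * (2 * (3 * n) * Real.pi)) by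
          rw [Real.sqrt_mul (by positivity : (0 : ℝ) ≤ (3 * n) ^ 2), Real.sqrt_sq (by positivity)]]
      congr 1
      field_simp
      ring
    have hp : (3 * n / Real.exp 1 : ℝ) ^ (3 * n) * 4 ^ n =
        27 ^ n * ((n / Real.exp 1) ^ n * (2 * n / Real.exp 1) ^ (2 * n)) := by
      rw [pow_mul, pow_mul, ← mul_pow, ← mul_pow, ← mul_pow]
      congr 1
      field_simp
      ring
    have h1 : √(2 * n * Real.pi) ≠ 0 := by positivity
    have h2 : √(2 * (2 * n) * Real.pi) ≠ 0 := by positivity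
    have h3 : (n / Real.exp 1 : ℝ) ^ n ≠ 0 := by positivity
    have h4 : (2 * n / Real.exp 1 : ℝ) ^ (2 * n) ≠ 0 := by positivity
    rw [div_mul_div_comm, div_eq_iff (by positivity)]
    linear_combination (3 * n * √(2 * (3 * n) * Real.pi)) * hp -
      27 ^ n * ((n / Real.exp 1 : ℝ) ^ n * (2 * n / Real.exp 1) ^ (2 * n)) * hs

/-- The error term is negligible. -/
theorem sqrt_sqrt_isLittleO :
    (fun n : ℕ => √(√(12 * n) / 2)) =o[atTop] (fun n : ℕ => √(27 * (n : ℝ) / (4 * Real.pi))) := by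
  have hpi := Real.pi_pos
  have hpi4 := Real.pi_le_four
  have h : Tendsto (fun n : ℕ => √(√(n : ℝ))) atTop atTop :=
    Real.tendsto_sqrt_atTop.comp (Real.tendsto_sqrt_atTop.comp tendsto_natCast_atTop_atTop)
  rw [isLittleO_iff]
  intro c hc
  filter_upwards [h.eventually_ge_atTop (2 / c)] with n hn
  rw [Real.norm_of_nonneg (by positivity), Real.norm_of_nonneg (by positivity)]
  have h1 : √(√(12 * (n : ℝ)) / 2) ≤ 2 * √(√(n : ℝ)) := by
    rw [show (2 : ℝ) = √4 by rw [show (4 : ℝ) = 2 ^ 2 by norm_num]; simp,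
      ← Real.sqrt_mul (by positivity)]
    refine Real.sqrt_le_sqrt ?_
    rw [Real.sqrt_mul (by norm_num)]
    have : √(12 : ℝ) ≤ 4 := Real.sqrt_le_iff.mpr (by norm_num)
    have h0 := Real.sqrt_nonneg (n : ℝ)
    have e : √(4 : ℝ) = 2 := by rw [show (4 : ℝ) = 2 ^ 2 by norm_num]; simp
    rw [e]
    nlinarith
  have h2 : √(n : ℝ) ≤ √(27 * (n : ℝ) / (4 * Real.pi)) := by
    refine Real.sqrt_le_sqrt ?_
    rw [le_div_iff₀ (by positivity)]
    have : (0 : ℝ) ≤ n := by positivity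
    nlinarith
  have h3 : √(√(n : ℝ)) * √(√(n : ℝ)) = √(n : ℝ) := Real.mul_self_sqrt (by positivity)
  have h4 : 2 ≤ √(√(n : ℝ)) * c := (div_le_iff₀ hc).mp hn
  calc _ ≤ 2 * √(√(n : ℝ)) := h1
    _ ≤ (√(√(n : ℝ)) * c) * √(√(n : ℝ)) := by gcongr
    _ = c * √(n : ℝ) := by linear_combination c * h3
    _ ≤ _ := by gcongr

theorem expectedScore_isEquivalent (ρ : ∀ n : ℕ, RestrictedStrategy n) (σ : ℕ → NormalStrategy)
    (hρ : ∀ n, (ρ n).IsOptimal) (hσ : ∀ n, (σ n).IsOptimal n) :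
    (fun n : ℕ => expectedScore (ρ n) (σ n)) ~[atTop]
      (fun n : ℕ => √(27 * (n : ℝ) / (4 * Real.pi))) := by
  have h := sqrt_sqrt_isLittleO
  have hO : (fun n : ℕ => expectedScore (ρ n) (σ n) - meanSpread (3 * n) (fun _ => (n : ℤ)))
      =O[atTop] (fun n : ℕ => √(√(12 * n) / 2)) := by
    refine IsBigO.of_bound 1 (Eventually.of_forall fun n => ?_)
    have h1 := hσ n (equalizingStrategy n) _ (fun ρ' => meanSpread_le_expectedScore ρ') (ρ n)
    have h2 := hρ n (uniformStrategy n) _ (fun σ' => expectedScore_le σ') (σ n)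
    rw [Real.norm_of_nonneg (sub_nonneg.mpr h1), Real.norm_of_nonneg (by positivity)]
    linarith
  refine (meanSpread_isEquivalent.add_isLittleO (hO.trans_isLittleO h)).congr_left ?_
  exact Eventually.of_forall fun n => by simp

/-! ### Existence of optimal strategies -/

/-- The expected score, extended to arbitrary weights, depends continuously on both strategies. -/
theorem continuous_sum_plays {n : ℕ} {X : Type*} [TopologicalSpace X]
    {p q : X → History → Move → ℝ} (hp : Continuous p) (hq : Continuous q) :
    Continuous fun x => ∑ ω : Play n,
      (∏ t, p x (ω.before t) (ω t).1 * q x (ω.before t) (ω t).2) * ω.score := by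
  fun_prop

theorem isCompact_strategies :
    IsCompact {p : History → Move → ℝ | ∀ h, p h ∈ stdSimplex ℝ Move} :=
  isCompact_pi_infinite fun _ => isCompact_stdSimplex ℝ Move

/-- The worst expected score is an upper semicontinuous function on a compact space. -/
theorem exists_isOptimal_normal (n : ℕ) : ∃ σ : NormalStrategy, σ.IsOptimal n := by
  let f : (History → Move → ℝ) → EReal := fun q => ⨅ ρ : RestrictedStrategy n,
    ((∑ ω : Play n, (∏ t, ρ.prob (ω.before t) (ω t).1 * q (ω.before t) (ω t).2) * ω.score : ℝ) :
      EReal)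
  have hf : UpperSemicontinuous f := upperSemicontinuous_iInf fun ρ =>
    (continuous_coe_real_ereal.comp
      (continuous_sum_plays continuous_const continuous_id)).upperSemicontinuous
  obtain ⟨q, hq, hmax⟩ := UpperSemicontinuousOn.exists_isMaxOn
    (s := {q : History → Move → ℝ | ∀ h, q h ∈ stdSimplex ℝ Move})
    ⟨(equalizingStrategy n).prob, (equalizingStrategy n).prob_mem⟩ isCompact_strategies
    (hf.upperSemicontinuousOn _)
  refine ⟨⟨q, hq⟩, fun σ' v hv ρ => ?_⟩
  have h1 : (v : EReal) ≤ f σ'.prob := le_iInf fun ρ => EReal.coe_le_coe_iff.mpr (hv ρ)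
  exact EReal.coe_le_coe_iff.mp ((h1.trans (hmax σ'.prob_mem)).trans (iInf_le _ ρ))

/-- The best expected score is a lower semicontinuous function on a compact space. -/
theorem exists_isOptimal_restricted (n : ℕ) : ∃ ρ : RestrictedStrategy n, ρ.IsOptimal := by
  let f : (History → Move → ℝ) → EReal := fun p => ⨆ σ : NormalStrategy,
    ((∑ ω : Play n, (∏ t, p (ω.before t) (ω t).1 * σ.prob (ω.before t) (ω t).2) * ω.score : ℝ) :
      EReal)
  have hf : LowerSemicontinuous f := lowerSemicontinuous_iSup fun σ =>
    (continuous_coe_real_ereal.comp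
      (continuous_sum_plays continuous_id continuous_const)).lowerSemicontinuous
  have hclosed : IsClosed {p : History → Move → ℝ | ∀ h : History, h.length < 3 * n →
      ∀ i : Move, n ≤ (h.map Prod.fst).count i → p h i = 0} := by
    simp only [Set.ofPred_forall]
    exact isClosed_iInter fun h => isClosed_iInter fun _ => isClosed_iInter fun i =>
      isClosed_iInter fun _ => isClosed_eq (by fun_prop) continuous_const
  obtain ⟨p, hp, hmin⟩ := LowerSemicontinuousOn.exists_isMinOn
    (s := {p : History → Move → ℝ | ∀ h, p h ∈ stdSimplex ℝ Move} ∩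
      {p | ∀ h : History, h.length < 3 * n →
        ∀ i : Move, n ≤ (h.map Prod.fst).count i → p h i = 0})
    ⟨(uniformStrategy n).prob, (uniformStrategy n).prob_mem, (uniformStrategy n).legal⟩
    (isCompact_strategies.inter_right hclosed) (hf.lowerSemicontinuousOn _)
  refine ⟨⟨p, hp.1, hp.2⟩, fun ρ' v hv σ => ?_⟩
  have h1 : f ρ'.prob ≤ (v : EReal) := iSup_le fun σ => EReal.coe_le_coe_iff.mpr (hv σ)
  exact EReal.coe_le_coe_iff.mp (((le_iSup (fun σ : NormalStrategy =>
    ((∑ ω : Play n, (∏ t, p (ω.before t) (ω t).1 * σ.prob (ω.before t) (ω t).2) * ω.score : ℝ) :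
      EReal)) σ).trans (hmin ⟨ρ'.prob_mem, ρ'.legal⟩)).trans h1)

/-! ### The constant -/

theorem sqrt_eq_const_mul (x : ℝ) : √(27 * x / (4 * Real.pi)) =
    3 * √3 / (2 * √Real.pi) * √x := by
  have h27 : √(27 : ℝ) = 3 * √3 := by
    rw [show (27 : ℝ) = 3 ^ 2 * 3 by norm_num, Real.sqrt_mul (by norm_num),
      Real.sqrt_sq (by norm_num)]
  have h4 : √(4 : ℝ) = 2 := by
    rw [show (4 : ℝ) = 2 ^ 2 by norm_num, Real.sqrt_sq (by norm_num)]
  rw [Real.sqrt_div' _ (by positivity), Real.sqrt_mul (by norm_num), Real.sqrt_mul (by norm_num),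
    h27, h4]
  ring

theorem abs_const_sub_lt : |3 * √3 / (2 * √Real.pi) - 1.4658| < 0.00005 := by
  have h := sqrt_eq_const_mul 1
  rw [Real.sqrt_one, mul_one, mul_one] at h
  have h1 := Real.pi_gt_d6
  have h2 := Real.pi_lt_d6
  rw [← h, abs_lt]
  constructor
  · have : (1.46576 : ℝ) ≤ √(27 / (4 * Real.pi)) := by
      apply Real.le_sqrt_of_sq_le
      rw [le_div_iff₀ (by positivity)]
      norm_num
      linarith
    linarith
  · have : √(27 / (4 * Real.pi)) ≤ 1.46584 := by
      refine Real.sqrt_le_iff.mpr ⟨by norm_num, ?_⟩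
      rw [div_le_iff₀ (by positivity)]
      norm_num
      linarith
    linarith

end SemiRPS

theorem theorem1 :
    -- both players have optimal strategies
    (∀ n : ℕ, (∃ ρ : SemiRPS.RestrictedStrategy n, ρ.IsOptimal) ∧
      (∃ σ : SemiRPS.NormalStrategy, σ.IsOptimal n)) ∧
    -- the expected score when both play optimally
    (∀ (ρ : ∀ n : ℕ, SemiRPS.RestrictedStrategy n) (σ : ℕ → SemiRPS.NormalStrategy),
      (∀ n, (ρ n).IsOptimal) → (∀ n, (σ n).IsOptimal n) →
        (fun n : ℕ => SemiRPS.expectedScore (ρ n) (σ n)) ~[atTop]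
          (fun n : ℕ => Real.sqrt (27 * (n : ℝ) / (4 * Real.pi)))) ∧
    -- the two forms of the limit, and the numerical value of the constant
    (∀ n : ℕ, Real.sqrt (27 * (n : ℝ) / (4 * Real.pi)) =
      3 * Real.sqrt 3 / (2 * Real.sqrt Real.pi) * Real.sqrt (n : ℝ)) ∧
    |3 * Real.sqrt 3 / (2 * Real.sqrt Real.pi) - 1.4658| < 0.00005 :=
  ⟨fun n => ⟨SemiRPS.exists_isOptimal_restricted n, SemiRPS.exists_isOptimal_normal n⟩,
    SemiRPS.expectedScore_isEquivalent, fun n => SemiRPS.sqrt_eq_const_mul n,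
    SemiRPS.abs_const_sub_lt⟩
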